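/- Let $f:\mathbb{R}^d\to\mathbb{R}^d$ ($d\ge 1$) be locally Lipschitz, let $\sigma\in\mathbb{R}^{d\times m}$, and consider $dX_t=f(X_t)\,dt+\sigma\,dB_t$ with $B$ a standard $m$-dimensional Brownian motion. Let $\mu$ be an invariant probability law of this equation (for instance its ergodic measure), and let $(X^{(r)},B^{(r)})$, $r=1,\dots,M$, $M\ge 1$, be independent trajectories, each $X^{(r)}$ being a global solution driven by $B^{(r)}$ with $X^{(r)}_0\sim\mu$. For $\delta>0$ put $t_n=n\delta$ and $\Delta B_{t_n}=B_{t_{n+1}}-B_{t_n}$. A parametric form is a family $F^\delta(c;x,\xi)$ with components $F^\delta_k(c;x,\xi)=\sum_{i=0}^p c_{i,k}\,\phi_i^k(x,\xi)$, $k=1,\dots,d$, where the $\phi_i=\phi_i^\delta:\mathbb{R}^d\times\mathbb{R}^m\to\mathbb{R}^d$ are measurable. It parametrizes the explicit scheme $X_{n+1}=X_n+\delta F^\delta(X_n,\xi_n)$ if, for every $\delta>0$, there is $c^*$ with $F^\delta(x,\xi)=F^\delta(c^*;x,\xi)$ for all $x,\xi$. From $N\ge1$ steps of each trajectory the coefficients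 are estimated componentwise by least squares, $\hat c_{\cdot,k}=\bar A_k^{+}\bar b_k$, where $^+$ is the Moore--Penrose pseudo-inverse and $$\bar A_k(i,j)=\frac1{MN}\sum_{r=1}^M\sum_{n=0}^{N-1}\phi_i^k\phi_j^k,\qquad \bar b_k(i)=\frac1{MN}\sum_{r=1}^M\sum_{n=0}^{N-1}\frac{X^{(r),k}_{t_{n+1}}-X^{(r),k}_{t_n}}{\delta}\,\phi_i^k,$$ the $\phi$'s being evaluated at $(X^{(r)}_{t_n},\Delta B^{(r)}_{t_n})$. The estimated residual variances, of the components and of the whole scheme, are $$\hat\sigma_k^2=\frac1{\delta^2MN}\sum_{r=1}^M\sum_{n=0}^{N-1}\bigl|X^{(r),k}_{t_{n+1}}-X^{(r),k}_{t_n}-\delta F_k^\delta(\hat c;X^{(r)}_{t_n},\Delta B^{(r)}_{t_n})\bigr|^2,$$ $$\hat\sigma^2=\frac{2}{d\,\delta^2MN}\sum_{r=1}^M\sum_{n=0}^{N-1}\bigl|X^{(r)}_{t_{n+1}}-X^{(r)}_{t_n}-\delta F^\delta(\hat c;X^{(r)}_{t_n},\Delta B^{(r)}_{t_n})\bigr|^2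 .$$ If the parametric form parametrizes an explicit scheme with flow map $F^\delta$, then for all $\delta>0$ and $N\ge 1$, all $n\ge 0$ and every trajectory $(X,B)=(X^{(r)},B^{(r)})$, $\hat\sigma_k^2$ and $\hat\sigma^2$ are random variables and (with expectations in $[0,\infty]$) $$\mathbb{E}\,\hat\sigma^2\le\frac2d\,\mathbb{E}\Bigl[\Bigl|\frac{X_{t_{n+1}}-X_{t_n}}{\delta}-F^\delta(X_{t_n},\Delta B_{t_n})\Bigr|^2\Bigr],$$ and, for every component $k$, $$\mathbb{E}\,\hat\sigma_k^2\le\mathbb{E}\Bigl[\Bigl|\frac{X^k_{t_{n+1}}-X^k_{t_n}}{\delta}-F_k^\delta(X_{t_n},\Delta B_{t_n})\Bigr|^2\Bigr].$$ Hence the inferred scheme has at least the one-step strong order of the explicit scheme: for every $\gamma\in\mathbb{R}$, if $\mathbb{E}\bigl[|(X_{t_{n+1}}-X_{t_n})/\delta-F^\delta(X_{t_n},\Delta B_{t_n})|^2\bigr]^{1/2}=O(\delta^\gamma)$ as $\delta\downarrow0$ (for some fixed $n$ and trajectory), then $(\mathbb{E}\,\hat\sigma^2)^{1/2}=O(\delta^\gamma)$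 as $\delta\downarrow 0$, for any choice of the sample length $N=N(\delta)\ge1$. This applies to IS-EM, with basis $x,\ f(x),\ \sigma\xi/\delta$, which parametrizes the Euler--Maruyama flow map $f(x)+\sigma\xi/\delta$, and to IS-RK4, with basis $x,\ \varphi(x,\xi),\ \sigma\xi/\delta$, where $\varphi=(k_1+2k_2+2k_3+k_4)/6$ is the standard Runge--Kutta increment with constant force $g=\sigma\xi/\delta$, that is, $k_1=f(x)+g$, $k_2=f(x+\tfrac\delta2k_1)+g$, $k_3=f(x+\tfrac\delta2k_2)+g$, $k_4=f(x+\delta k_3)+g$; it parametrizes the flow map $\varphi$, and also $\varphi+\sigma\xi/\delta$. -/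

import Mathlib

open MeasureTheory ProbabilityTheory Filter Topology
open scoped NNReal ENNReal

universe u

/-! ### Moore-Penrose pseudo-inverse of a square real matrix -/

/-- The four Penrose equations: `P` is the Moore-Penrose pseudo-inverse of `A`. -/
structure IsMoorePenrose {n : Type*} [Fintype n] (A P : Matrix n n ℝ) : Prop where
  mul_mul_left : A * P * A = A
  mul_mul_right : P * A * P = P
  left_symm : (A * P).transpose = A * P
  right_symm : (P * A).transpose = P * A

theorem exists_isMoorePenrose_of_isHermitian {n : Type*} [Fintype n] [DecidableEq n]
    {H : Matrix n n ℝ} (hH : H.IsHermitian) :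
    ∃ S : Matrix n n ℝ, IsMoorePenrose H S ∧ S.transpose = S := by
  obtain ⟨U, D, hU, hU', hHD⟩ : ∃ (U : Matrix n n ℝ) (D : n → ℝ),
      U.transpose * U = 1 ∧ U * U.transpose = 1 ∧
        H = U * Matrix.diagonal D * U.transpose := by
    refine ⟨hH.eigenvectorUnitary, hH.eigenvalues, ?_, ?_, ?_⟩
    · have := (Matrix.mem_unitaryGroup_iff'.1 hH.eigenvectorUnitary.2)
      simpa [Matrix.star_eq_conjTranspose] using this
    · have := (Matrix.mem_unitaryGroup_iff.1 hH.eigenvectorUnitary.2)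
      simpa [Matrix.star_eq_conjTranspose] using this
    · have := hH.spectral_theorem
      simpa [Unitary.conjStarAlgAut_apply, Matrix.star_eq_conjTranspose,
        Function.comp_def] using this
  have key : ∀ a b : n → ℝ, U * Matrix.diagonal a * U.transpose *
      (U * Matrix.diagonal b * U.transpose) =
      U * Matrix.diagonal (fun i => a i * b i) * U.transpose := by
    intro a b
    calc _ = U * Matrix.diagonal a * (U.transpose * U) * Matrix.diagonal b * U.transpose := by
            simp only [Matrix.mul_assoc]
      _ = _ := by
            rw [hU, Matrix.mul_one, Matrix.mul_assoc U, Matrix.diagonal_mul_diagonal]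
  have tr : ∀ a : n → ℝ, (U * Matrix.diagonal a * U.transpose).transpose =
      U * Matrix.diagonal a * U.transpose := by
    intro a
    simp [Matrix.transpose_mul, Matrix.mul_assoc]
  refine ⟨U * Matrix.diagonal (fun i => (D i)⁻¹) * U.transpose, ⟨?_, ?_, ?_, ?_⟩, tr _⟩
  · rw [hHD, key, key]
    congr 3; ext i; simp
  · rw [hHD, key, key]
    congr 3; ext i
    by_cases h : D i = 0 <;> simp [h]
  · rw [hHD, key, tr]
  · rw [hHD, key, tr]

theorem exists_isMoorePenrose {n : Type*} [Fintype n] [DecidableEq n] (A : Matrix n n ℝ) :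
    ∃ P : Matrix n n ℝ, IsMoorePenrose A P := by
  have hH : (A.transpose * A).IsHermitian := by
    simpa using Matrix.isHermitian_conjTranspose_mul_self A
  obtain ⟨S, hS, hSt⟩ := exists_isMoorePenrose_of_isHermitian hH
  refine ⟨S * A.transpose, ⟨?_, ?_, ?_, ?_⟩⟩
  · have h0 : (A * S * (A.transpose * A) - A).transpose *
        (A * S * (A.transpose * A) - A) = 0 := by
      have h1 := hS.mul_mul_left
      simp only [Matrix.transpose_sub, Matrix.transpose_mul, Matrix.transpose_transpose, hSt,
        Matrix.sub_mul, Matrix.mul_sub, Matrix.mul_assoc] at h1 ⊢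
      simp only [← Matrix.mul_assoc] at h1 ⊢
      simp [h1]
    have h2 : A * S * (A.transpose * A) - A = 0 := by
      rw [← Matrix.conjTranspose_eq_transpose_of_trivial] at h0
      exact Matrix.conjTranspose_mul_self_eq_zero.1 h0
    have h3 := sub_eq_zero.1 h2
    simpa only [Matrix.mul_assoc] using h3
  · have := congrArg (· * A.transpose) hS.mul_mul_right
    simpa only [Matrix.mul_assoc] using this
  · simp [Matrix.transpose_mul, hSt, Matrix.mul_assoc]
  · simpa only [Matrix.mul_assoc] using hS.right_symm

/-- The Moore-Penrose pseudo-inverse `A⁺`, the (unique) solution of the Penrose equations. -/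
noncomputable def pseudoInverse {n : Type*} [Fintype n] [DecidableEq n] (A : Matrix n n ℝ) :
    Matrix n n ℝ :=
  (exists_isMoorePenrose A).choose

/-! ### The stochastic differential equation `dX = f(X) dt + σ dB` -/

/-- The vector `σ ξ` in the state space, for `ξ` in the noise space. -/
noncomputable def noiseTerm {d m : ℕ} (σ : Matrix (Fin d) (Fin m) ℝ)
    (ξ : EuclideanSpace ℝ (Fin m)) : EuclideanSpace ℝ (Fin d) :=
  WithLp.toLp 2 (σ.mulVec (WithLp.ofLp ξ))

/-- `B` is a standard `m`-dimensional Brownian motion relative to the filtration `ℱ`. -/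
structure IsFilteredBrownian {Ω : Type*} [mΩ : MeasurableSpace Ω] {m : ℕ} (P : Measure Ω)
    (ℱ : Filtration ℝ≥0 mΩ) (B : ℝ≥0 → Ω → EuclideanSpace ℝ (Fin m)) : Prop where
  isBrownianReal_coord : ∀ k : Fin m, IsBrownianReal (fun t ω => B t ω k) P
  indep_coord : iIndepFun (fun (k : Fin m) (ω : Ω) (t : ℝ≥0) => B t ω k) P
  adapted : Adapted ℱ B
  indep_increment : ∀ s t : ℝ≥0, s ≤ t →
    Indep (MeasurableSpace.comap (fun ω => B t ω - B s ω) inferInstance) (ℱ s) P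

/-- `X` is a global solution of `dX = f(X) dt + σ dB`: it is adapted, has continuous paths, and
`X_t = X_0 + ∫_0^t f(X_s) ds + σ B_t` for all `t ≥ 0`, almost surely. (The noise is additive, so
that `∫_0^t σ dB_s = σ B_t`.) -/
structure IsSDESolution {Ω : Type*} [mΩ : MeasurableSpace Ω] {d m : ℕ}
    (f : EuclideanSpace ℝ (Fin d) → EuclideanSpace ℝ (Fin d)) (σ : Matrix (Fin d) (Fin m) ℝ)
    (P : Measure Ω) (ℱ : Filtration ℝ≥0 mΩ) (B : ℝ≥0 → Ω → EuclideanSpace ℝ (Fin m))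
    (X : ℝ≥0 → Ω → EuclideanSpace ℝ (Fin d)) : Prop where
  brownian : IsFilteredBrownian P ℱ B
  adapted : Adapted ℱ X
  continuous_paths : ∀ᵐ ω ∂P, Continuous fun t => X t ω
  integral_eq : ∀ᵐ ω ∂P, ∀ t : ℝ≥0,
    X t ω = X 0 ω + (∫ s in (0 : ℝ)..t, f (X s.toNNReal ω)) + noiseTerm σ (B t ω)

/-- `μ` is an invariant law of the equation: a solution whose initial value has law `μ` has
law `μ` at every time. -/
def IsInvariantLaw {d m : ℕ} (f : EuclideanSpace ℝ (Fin d) → EuclideanSpace ℝ (Fin d))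
    (σ : Matrix (Fin d) (Fin m) ℝ) (μ : Measure (EuclideanSpace ℝ (Fin d))) : Prop :=
  ∀ (Ω : Type u) (mΩ : MeasurableSpace Ω) (P : Measure Ω) (_ : IsProbabilityMeasure P)
    (ℱ : Filtration ℝ≥0 mΩ) (B : ℝ≥0 → Ω → EuclideanSpace ℝ (Fin m))
    (X : ℝ≥0 → Ω → EuclideanSpace ℝ (Fin d)),
    IsSDESolution f σ P ℱ B X → P.map (X 0) = μ → ∀ t : ℝ≥0, P.map (X t) = μ

/-- The observations are made on `M` independent trajectories `(X^r, B^r)` of the equation, all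
started from the law `μ`. -/
structure IsTrajectorySample {Ω : Type*} [mΩ : MeasurableSpace Ω] {d m M : ℕ}
    (f : EuclideanSpace ℝ (Fin d) → EuclideanSpace ℝ (Fin d)) (σ : Matrix (Fin d) (Fin m) ℝ)
    (μ : Measure (EuclideanSpace ℝ (Fin d))) (P : Measure Ω)
    (ℱ : Fin M → Filtration ℝ≥0 mΩ) (B : Fin M → ℝ≥0 → Ω → EuclideanSpace ℝ (Fin m))
    (X : Fin M → ℝ≥0 → Ω → EuclideanSpace ℝ (Fin d)) : Prop where
  solution : ∀ r, IsSDESolution f σ P (ℱ r) (B r) (X r)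
  initial : ∀ r, P.map (X r 0) = μ
  indep : iIndepFun (fun (r : Fin M) (ω : Ω) (t : ℝ≥0) => (X r t ω, B r t ω)) P

/-! ### Flow maps, explicit schemes and their linear parametrizations -/

/-- `(X_{t_{n+1}} - X_{t_n}) / δ` with `t_n = n δ`. -/
noncomputable def flowIncrement {Ω : Type*} {d : ℕ} (X : ℝ≥0 → Ω → EuclideanSpace ℝ (Fin d))
    (δ : ℝ≥0) (n : ℕ) (ω : Ω) : EuclideanSpace ℝ (Fin d) :=
  (δ : ℝ)⁻¹ • (X ((n + 1) * δ) ω - X (n * δ) ω)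

/-- `ΔB_{t_n} = B_{t_{n+1}} - B_{t_n}` with `t_n = n δ`. -/
noncomputable def noiseIncrement {Ω : Type*} {m : ℕ} (B : ℝ≥0 → Ω → EuclideanSpace ℝ (Fin m))
    (δ : ℝ≥0) (n : ℕ) (ω : Ω) : EuclideanSpace ℝ (Fin m) :=
  B ((n + 1) * δ) ω - B (n * δ) ω

/-- The one-step map of a scheme `X_{n+1} = X_n + δ F^δ(X_n, ξ_n)`, for each time step `δ`. -/
abbrev FlowMap (d m : ℕ) : Type :=
  ℝ≥0 → EuclideanSpace ℝ (Fin d) → EuclideanSpace ℝ (Fin m) → EuclideanSpace ℝ (Fin d)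

/-- The parametric flow map `∑ i, c_i φ_i(x, ξ)`, with one set of coefficients for each
component of the state. -/
noncomputable def parametricFlow {d m p : ℕ} (φ : Fin (p + 1) → FlowMap d m)
    (c : Fin (p + 1) → Fin d → ℝ) : FlowMap d m :=
  fun δ x ξ => WithLp.toLp 2 fun k => ∑ i, c i k * φ i δ x ξ k

/-- The parametric form with basis `φ` parametrizes the explicit scheme with flow map `F`: the
basis functions are measurable and `F^δ` is a member of the parametric family. -/
def Parametrizes {d m p : ℕ} (φ : Fin (p + 1) → FlowMap d m) (F : FlowMap d m) : Prop :=
  ∀ δ : ℝ≥0, 0 < δ →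
    (∀ i, Measurable fun z : EuclideanSpace ℝ (Fin d) × EuclideanSpace ℝ (Fin m) =>
      φ i δ z.1 z.2) ∧
    ∃ c : Fin (p + 1) → Fin d → ℝ, ∀ x ξ, F δ x ξ = parametricFlow φ c δ x ξ

/-- Flow map of the Euler-Maruyama scheme. -/
noncomputable def emFlow {d m : ℕ} (f : EuclideanSpace ℝ (Fin d) → EuclideanSpace ℝ (Fin d))
    (σ : Matrix (Fin d) (Fin m) ℝ) : FlowMap d m :=
  fun δ x ξ => f x + (δ : ℝ)⁻¹ • noiseTerm σ ξ

/-- Basis of IS-EM: the state, and the two terms of the Euler-Maruyama flow map. -/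
noncomputable def emBasis {d m : ℕ} (f : EuclideanSpace ℝ (Fin d) → EuclideanSpace ℝ (Fin d))
    (σ : Matrix (Fin d) (Fin m) ℝ) : Fin (2 + 1) → FlowMap d m :=
  ![fun _ x _ => x, fun _ x _ => f x, fun δ _ ξ => (δ : ℝ)⁻¹ • noiseTerm σ ξ]

/-- `φ₁(x, σξ)`: the standard fourth-order Runge-Kutta increment for the drift `f`, with the
stochastic force `σξ/δ` treated as a constant input. -/
noncomputable def rk4Increment {d m : ℕ}
    (f : EuclideanSpace ℝ (Fin d) → EuclideanSpace ℝ (Fin d))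
    (σ : Matrix (Fin d) (Fin m) ℝ) : FlowMap d m :=
  fun δ x ξ =>
    let g := (δ : ℝ)⁻¹ • noiseTerm σ ξ
    let k₁ := f x + g
    let k₂ := f (x + ((δ : ℝ) / 2) • k₁) + g
    let k₃ := f (x + ((δ : ℝ) / 2) • k₂) + g
    let k₄ := f (x + (δ : ℝ) • k₃) + g
    (1 / 6 : ℝ) • (k₁ + (2 : ℝ) • k₂ + (2 : ℝ) • k₃ + k₄)

/-- The flow map `φ₁(x, σξ) + σξ/δ`, in which the stochastic force is added once more to the
Runge-Kutta increment. -/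
noncomputable def rk4AddNoiseFlow {d m : ℕ}
    (f : EuclideanSpace ℝ (Fin d) → EuclideanSpace ℝ (Fin d))
    (σ : Matrix (Fin d) (Fin m) ℝ) : FlowMap d m :=
  fun δ x ξ => rk4Increment f σ δ x ξ + (δ : ℝ)⁻¹ • noiseTerm σ ξ

/-- Basis of IS-RK4: the state, the Runge-Kutta increment, and the stochastic force. -/
noncomputable def rk4Basis {d m : ℕ} (f : EuclideanSpace ℝ (Fin d) → EuclideanSpace ℝ (Fin d))
    (σ : Matrix (Fin d) (Fin m) ℝ) : Fin (2 + 1) → FlowMap d m :=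
  ![fun _ x _ => x, rk4Increment f σ, fun δ _ ξ => (δ : ℝ)⁻¹ • noiseTerm σ ξ]

/-! ### Least squares inference of the coefficients, and the residual -/

/-- The normal matrix `Ā_k`, for the `k`-th component of the state. -/
noncomputable def normalMatrix {Ω : Type*} {d m p M : ℕ} (φ : Fin (p + 1) → FlowMap d m)
    (B : Fin M → ℝ≥0 → Ω → EuclideanSpace ℝ (Fin m))
    (X : Fin M → ℝ≥0 → Ω → EuclideanSpace ℝ (Fin d)) (δ : ℝ≥0) (N : ℕ) (k : Fin d) (ω : Ω) :
    Matrix (Fin (p + 1)) (Fin (p + 1)) ℝ :=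
  Matrix.of fun i j => 1 / ((M : ℝ) * N) * ∑ r : Fin M, ∑ n ∈ Finset.range N,
    φ i δ (X r (n * δ) ω) (noiseIncrement (B r) δ n ω) k *
      φ j δ (X r (n * δ) ω) (noiseIncrement (B r) δ n ω) k

/-- The normal vector `b̄_k`, for the `k`-th component of the state. -/
noncomputable def normalVector {Ω : Type*} {d m p M : ℕ} (φ : Fin (p + 1) → FlowMap d m)
    (B : Fin M → ℝ≥0 → Ω → EuclideanSpace ℝ (Fin m))
    (X : Fin M → ℝ≥0 → Ω → EuclideanSpace ℝ (Fin d)) (δ : ℝ≥0) (N : ℕ) (k : Fin d) (ω : Ω) :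
    Fin (p + 1) → ℝ :=
  fun i => 1 / ((M : ℝ) * N) * ∑ r : Fin M, ∑ n ∈ Finset.range N,
    flowIncrement (X r) δ n ω k * φ i δ (X r (n * δ) ω) (noiseIncrement (B r) δ n ω) k

/-- The least squares estimator `ĉ_k = (Ā_k)⁺ b̄_k`, for every component `k`. -/
noncomputable def estimator {Ω : Type*} {d m p M : ℕ} (φ : Fin (p + 1) → FlowMap d m)
    (B : Fin M → ℝ≥0 → Ω → EuclideanSpace ℝ (Fin m))
    (X : Fin M → ℝ≥0 → Ω → EuclideanSpace ℝ (Fin d)) (δ : ℝ≥0) (N : ℕ) (ω : Ω) :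
    Fin (p + 1) → Fin d → ℝ :=
  fun i k => (pseudoInverse (normalMatrix φ B X δ N k ω)).mulVec
    (normalVector φ B X δ N k ω) i

/-- The estimated residual variance of the `k`-th component. -/
noncomputable def residualVarianceCoord {Ω : Type*} {d m p M : ℕ}
    (φ : Fin (p + 1) → FlowMap d m) (B : Fin M → ℝ≥0 → Ω → EuclideanSpace ℝ (Fin m))
    (X : Fin M → ℝ≥0 → Ω → EuclideanSpace ℝ (Fin d)) (δ : ℝ≥0) (N : ℕ) (k : Fin d) (ω : Ω) :
    ℝ :=
  1 / (δ : ℝ) ^ 2 * (1 / ((M : ℝ) * N)) * ∑ r : Fin M, ∑ n ∈ Finset.range N,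
    ((X r ((n + 1) * δ) ω - X r (n * δ) ω - (δ : ℝ) • parametricFlow φ
      (estimator φ B X δ N ω) δ (X r (n * δ) ω) (noiseIncrement (B r) δ n ω)) k) ^ 2

/-- The estimated residual variance of the inferred scheme. -/
noncomputable def residualVariance {Ω : Type*} {d m p M : ℕ}
    (φ : Fin (p + 1) → FlowMap d m) (B : Fin M → ℝ≥0 → Ω → EuclideanSpace ℝ (Fin m))
    (X : Fin M → ℝ≥0 → Ω → EuclideanSpace ℝ (Fin d)) (δ : ℝ≥0) (N : ℕ) (ω : Ω) : ℝ :=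
  2 / (d * (δ : ℝ) ^ 2) * (1 / ((M : ℝ) * N)) * ∑ r : Fin M, ∑ n ∈ Finset.range N,
    ‖X r ((n + 1) * δ) ω - X r (n * δ) ω - (δ : ℝ) • parametricFlow φ
      (estimator φ B X δ N ω) δ (X r (n * δ) ω) (noiseIncrement (B r) δ n ω)‖ ^ 2

/-- `E |(X_{t_{n+1}} - X_{t_n})/δ - F^δ(X_{t_n}, ΔB_{t_n})|²`, an element of `[0, ∞]`. -/
noncomputable def oneStepError {Ω : Type*} [MeasurableSpace Ω] {d m : ℕ} (F : FlowMap d m)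
    (P : Measure Ω) (B : ℝ≥0 → Ω → EuclideanSpace ℝ (Fin m))
    (X : ℝ≥0 → Ω → EuclideanSpace ℝ (Fin d)) (δ : ℝ≥0) (n : ℕ) : ℝ≥0∞ :=
  ∫⁻ ω, ‖flowIncrement X δ n ω - F δ (X (n * δ) ω) (noiseIncrement B δ n ω)‖ₑ ^ 2 ∂P

/-- The contribution of the `k`-th component to `oneStepError`. -/
noncomputable def oneStepErrorCoord {Ω : Type*} [MeasurableSpace Ω] {d m : ℕ}
    (F : FlowMap d m) (P : Measure Ω) (B : ℝ≥0 → Ω → EuclideanSpace ℝ (Fin m))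
    (X : ℝ≥0 → Ω → EuclideanSpace ℝ (Fin d)) (δ : ℝ≥0) (n : ℕ) (k : Fin d) : ℝ≥0∞ :=
  ∫⁻ ω, ‖(flowIncrement X δ n ω - F δ (X (n * δ) ω) (noiseIncrement B δ n ω)) k‖ₑ ^ 2 ∂P

/-- A mean-square one-step error `e(δ)` (of the flow map) has strong order `γ`: its root is
`O(δ^γ)` as the time step `δ` decreases to `0`. -/
def HasOneStepStrongOrder (e : ℝ≥0 → ℝ≥0∞) (γ : ℝ) : Prop :=
  ∃ C : ℝ≥0, ∀ᶠ δ in 𝓝[>] (0 : ℝ≥0), e δ ≤ ((C * δ ^ (2 * γ) : ℝ≥0) : ℝ≥0∞)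

/-
By the normal equations, `ĉ_k = Ā_k⁺ b̄_k` minimizes the empirical residual variance of the `k`-th
component over all coefficients. As `F^δ` belongs to the parametric family, `σ̂_k²` is thus at most
the empirical mean of the squared one-step errors of the explicit scheme; summing over `k` bounds
`σ̂²`. It remains to see that these errors all have the same expectation. The Euler scheme started
from `X_a` is driven by independent Gaussian increments, hence its law depends only on that of
`X_a`; it converges pathwise to the solution because `f` is locally Lipschitz and paths are bounded
on compact intervals. So the law of `(X_a, X_{a+δ}, B_{a+δ} - B_a)` depends only on the law of
`X_a`, which is `μ` at every time by invariance.

Measurability of `σ̂_k²` needs no measurability of the pseudo-inverse: a minimum of a continuous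
function of the coefficients is an infimum over a countable dense set.
-/

/-! ### Least squares -/

section LeastSquares

open scoped Matrix

variable {ι n : Type*} [Fintype ι] [Fintype n]

theorem isMoorePenrose_pseudoInverse [DecidableEq n] (A : Matrix n n ℝ) :
    IsMoorePenrose A (pseudoInverse A) :=
  (exists_isMoorePenrose A).choose_spec

/-- The residual sum of squares `‖y - Φ c‖²` of the linear model with design matrix `Φ`,
observations `y` and coefficients `c`. -/
def residualSumSq (Φ : Matrix ι n ℝ) (y : ι → ℝ) (c : n → ℝ) : ℝ :=
  ∑ z, (y z - (Φ *ᵥ c) z) ^ 2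

theorem residualSumSq_le_of_transpose_mulVec_eq_zero {Φ : Matrix ι n ℝ} {y : ι → ℝ} {c : n → ℝ}
    (hc : Φᵀ *ᵥ (y - Φ *ᵥ c) = 0) (c' : n → ℝ) :
    residualSumSq Φ y c ≤ residualSumSq Φ y c' := by
  have hcross : (y - Φ *ᵥ c) ⬝ᵥ Φ *ᵥ (c - c') = 0 := by
    rw [Matrix.dotProduct_mulVec, ← Matrix.mulVec_transpose, hc, zero_dotProduct]
  calc residualSumSq Φ y c
      ≤ residualSumSq Φ y c + ∑ z, (Φ *ᵥ (c - c')) z ^ 2 :=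
        le_add_of_nonneg_right (Finset.sum_nonneg fun _ _ => sq_nonneg _)
    _ = residualSumSq Φ y c + 2 * ((y - Φ *ᵥ c) ⬝ᵥ Φ *ᵥ (c - c')) +
          ∑ z, (Φ *ᵥ (c - c')) z ^ 2 := by rw [hcross, mul_zero, add_zero]
    _ = residualSumSq Φ y c' := by
        simp only [residualSumSq, dotProduct, Finset.mul_sum, ← Finset.sum_add_distrib,
          Matrix.mulVec_sub, Pi.sub_apply]
        exact Finset.sum_congr rfl fun z _ => by ring

theorem transpose_mulVec_residual_eq_zero_of_gram_mul_mul_gram {Φ : Matrix ι n ℝ}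
    {Q : Matrix n n ℝ} (hQ : Φᵀ * Φ * Q * (Φᵀ * Φ) = Φᵀ * Φ) (y : ι → ℝ) :
    Φᵀ *ᵥ (y - Φ *ᵥ (Q *ᵥ (Φᵀ *ᵥ y))) = 0 := by
  classical
  have hcancel : (Φᵀ * Φ * Q - 1) * Φᵀ = 0 := by
    refine (Matrix.mul_conjTranspose_mul_self_eq_zero Φ _).1 ?_
    rw [Matrix.conjTranspose_eq_transpose_of_trivial, Matrix.sub_mul, hQ, Matrix.one_mul, sub_self]
  rw [Matrix.sub_mul, Matrix.one_mul, sub_eq_zero] at hcancel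
  simp only [Matrix.mulVec_sub, Matrix.mulVec_mulVec, ← Matrix.mul_assoc, hcancel, sub_self]

theorem residualSumSq_pseudoInverse_le [DecidableEq n] (Φ : Matrix ι n ℝ) (y : ι → ℝ) {w : ℝ}
    (hw : w ≠ 0) (c : n → ℝ) :
    residualSumSq Φ y (pseudoInverse (w • (Φᵀ * Φ)) *ᵥ (w • (Φᵀ *ᵥ y))) ≤
      residualSumSq Φ y c := by
  set S := pseudoInverse (w • (Φᵀ * Φ))
  have hgram : Φᵀ * Φ * (w • S) * (Φᵀ * Φ) = Φᵀ * Φ := by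
    refine smul_right_injective _ hw ?_
    simpa using (isMoorePenrose_pseudoInverse (w • (Φᵀ * Φ))).mul_mul_left
  refine residualSumSq_le_of_transpose_mulVec_eq_zero ?_ c
  rw [Matrix.mulVec_smul, ← Matrix.smul_mulVec]
  exact transpose_mulVec_residual_eq_zero_of_gram_mul_mul_gram hgram y

end LeastSquares

theorem measurable_eval_minimizer {Ω E α : Type*} [MeasurableSpace Ω] [TopologicalSpace E]
    [TopologicalSpace.SeparableSpace E] [TopologicalSpace α] [LinearOrder α] [OrderTopology α]
    [SecondCountableTopology α] [MeasurableSpace α] [BorelSpace α] {g : Ω → E → α}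
    (hcont : ∀ ω, Continuous (g ω)) (hmeas : ∀ x, Measurable fun ω => g ω x) {x : Ω → E}
    (hmin : ∀ ω x', g ω (x ω) ≤ g ω x') : Measurable fun ω => g ω (x ω) := by
  obtain ⟨s, hs, hdense⟩ := TopologicalSpace.exists_countable_dense E
  have : Countable s := hs
  refine Measurable.isGLB (f := fun (q : s) ω => g ω q) (fun q => hmeas q) fun ω => ?_
  have hleast : IsLeast (Set.range (g ω)) (g ω (x ω)) :=
    ⟨⟨x ω, rfl⟩, by rintro _ ⟨x', rfl⟩; exact hmin ω x'⟩
  refine (isGLB_iff_of_subset_of_subset_closure ?_ ?_).2 hleast.isGLB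
  · rintro _ ⟨q, rfl⟩
    exact ⟨q, rfl⟩
  · rintro _ ⟨x', rfl⟩
    refine closure_mono ?_ (mem_closure_image (hcont ω).continuousAt (hdense x'))
    rintro _ ⟨q, hq, rfl⟩
    exact ⟨⟨q, hq⟩, rfl⟩

/-! ### Convergence of the Euler scheme along a path -/

section EulerScheme

variable {E : Type*} [NormedAddCommGroup E] [NormedSpace ℝ E] {f : E → E}

/-- The explicit Euler scheme `x_{k+1} = x_k + h f(x_k) + ξ_k` with step `h`, started from `x`. -/
def eulerScheme (f : E → E) (h : ℝ) (x : E) (ξ : ℕ → E) : ℕ → E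
  | 0 => x
  | k + 1 => eulerScheme f h x ξ k + h • f (eulerScheme f h x ξ k) + ξ k

theorem norm_eulerStep_sub_le {K : ℝ≥0} {s : Set E} (hf : LipschitzOnWith K f s)
    {h : ℝ} (hh : 0 ≤ h) {x y : E} (hx : x ∈ s) (hy : y ∈ s) (ξ y' : E) :
    ‖x + h • f x + ξ - y'‖ ≤ (1 + K * h) * ‖x - y‖ + ‖y' - y - h • f y - ξ‖ := by
  have hlip : ‖h • (f x - f y)‖ ≤ h * (K * ‖x - y‖) := by
    rw [norm_smul, Real.norm_of_nonneg hh]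
    gcongr
    exact hf.norm_sub_le hx hy
  calc ‖x + h • f x + ξ - y'‖ = ‖(x - y) + h • (f x - f y) - (y' - y - h • f y - ξ)‖ := by
        congr 1
        module
    _ ≤ ‖x - y‖ + ‖h • (f x - f y)‖ + ‖y' - y - h • f y - ξ‖ :=
        (norm_sub_le _ _).trans (add_le_add_left (norm_add_le _ _) _)
    _ ≤ (1 + K * h) * ‖x - y‖ + ‖y' - y - h • f y - ξ‖ := by linarith

/- The smallness of the bound itself keeps the scheme in the ball where `f` is Lipschitz. -/
theorem norm_eulerScheme_sub_le {K : ℝ≥0} {R : ℝ}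
    (hf : LipschitzOnWith K f (Metric.closedBall 0 (R + 1))) {h ε : ℝ} (hh : 0 ≤ h) (hε : 0 ≤ ε)
    {n : ℕ} (hsmall : n * h * ε * Real.exp (K * (n * h)) ≤ 1) {x ξ : ℕ → E}
    (hx : ∀ k ≤ n, ‖x k‖ ≤ R)
    (hloc : ∀ k < n, ‖x (k + 1) - x k - h • f (x k) - ξ k‖ ≤ h * ε) :
    ∀ k ≤ n, ‖eulerScheme f h (x 0) ξ k - x k‖ ≤ k * h * ε * Real.exp (K * (k * h)) := by
  intro k
  induction k with
  | zero => simp [eulerScheme]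
  | succ k ih =>
    intro hk
    have herr := ih (by lia)
    set z := eulerScheme f h (x 0) ξ k
    have hclose : ‖z - x k‖ ≤ 1 := by
      refine herr.trans (le_trans ?_ hsmall)
      have hkn : (k : ℝ) ≤ n := by exact_mod_cast (by lia : k ≤ n)
      gcongr
    have hxk := hx k (by lia)
    have hz_mem : z ∈ Metric.closedBall 0 (R + 1) := by
      rw [mem_closedBall_zero_iff]
      linarith [norm_le_norm_add_norm_sub' z (x k)]
    have hx_mem : x k ∈ Metric.closedBall 0 (R + 1) := by
      rw [mem_closedBall_zero_iff]
      linarith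
    have hexp : 1 + K * h ≤ Real.exp (K * h) := by linarith [Real.add_one_le_exp (K * h)]
    calc ‖z + h • f z + ξ k - x (k + 1)‖
        ≤ (1 + K * h) * ‖z - x k‖ + ‖x (k + 1) - x k - h • f (x k) - ξ k‖ :=
          norm_eulerStep_sub_le hf hh hz_mem hx_mem _ _
      _ ≤ Real.exp (K * h) * (k * h * ε * Real.exp (K * (k * h))) +
            h * ε * Real.exp (K * ((k + 1) * h)) := by
          gcongr
          exact (hloc k hk).trans (le_mul_of_one_le_right (by positivity)
            (Real.one_le_exp (by positivity)))
      _ = (k + 1 : ℕ) * h * ε * Real.exp (K * ((k + 1 : ℕ) * h)) := by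
          push_cast
          rw [show K * ((k + 1) * h) = K * h + K * (k * h) by ring, Real.exp_add]
          ring

theorem norm_integral_sub_smul_le [CompleteSpace E] {g : ℝ → E} {s t ε : ℝ} (hst : s ≤ t)
    (hg : IntervalIntegrable g volume s t) {v : E} (hv : ∀ u ∈ Set.Ioc s t, ‖g u - v‖ ≤ ε) :
    ‖(∫ u in s..t, g u) - (t - s) • v‖ ≤ (t - s) * ε := by
  rw [← intervalIntegral.integral_const, ← intervalIntegral.integral_sub hg
    intervalIntegrable_const, mul_comm, ← abs_of_nonneg (sub_nonneg.2 hst)]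
  exact intervalIntegral.norm_integral_le_of_norm_le_const (by rwa [Set.uIoc_of_le hst])

theorem norm_eulerScheme_sub_le_of_integral_eq [CompleteSpace E] {K : ℝ≥0} {R : ℝ}
    (hf : LipschitzOnWith K f (Metric.closedBall 0 (R + 1))) {x w : ℝ → E}
    (hfx : Continuous fun t => f (x t)) {a h ε : ℝ} (hh : 0 ≤ h) (hε : 0 ≤ ε) {n : ℕ}
    (hR : ∀ t ∈ Set.Icc a (a + n * h), ‖x t‖ ≤ R)
    (heq : ∀ s t, a ≤ s → s ≤ t → x t - x s = (∫ u in s..t, f (x u)) + (w t - w s))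
    (hosc : ∀ s ∈ Set.Icc a (a + n * h), ∀ t ∈ Set.Icc a (a + n * h), |s - t| ≤ h →
      ‖f (x s) - f (x t)‖ ≤ ε)
    (hsmall : n * h * ε * Real.exp (K * (n * h)) ≤ 1) :
    ‖eulerScheme f h (x a) (fun k => w (a + (k + 1 : ℕ) * h) - w (a + k * h)) n -
      x (a + n * h)‖ ≤ n * h * ε * Real.exp (K * (n * h)) := by
  have hgrid : ∀ k ≤ n, a + k * h ∈ Set.Icc a (a + n * h) := fun k hk =>
    ⟨by simpa using by positivity, by gcongr⟩
  have hloc : ∀ k < n, ‖x (a + (k + 1 : ℕ) * h) - x (a + k * h) - h • f (x (a + k * h)) -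
      (w (a + (k + 1 : ℕ) * h) - w (a + k * h))‖ ≤ h * ε := by
    intro k hk
    have hs := hgrid k hk.le
    have ht := hgrid (k + 1) hk
    have hlen : a + (k + 1 : ℕ) * h - (a + k * h) = h := by push_cast; ring
    have hle : a + k * h ≤ a + (k + 1 : ℕ) * h := by linarith
    have hint := norm_integral_sub_smul_le (v := f (x (a + k * h))) hle
      (hfx.intervalIntegrable _ _) fun u hu => hosc u ⟨hs.1.trans hu.1.le, hu.2.trans ht.2⟩ _ hs
        (abs_le.2 ⟨by linarith [hu.1], by linarith [hu.2]⟩)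
    rw [heq _ _ hs.1 hle]
    rw [hlen] at hint
    convert hint using 2
    abel
  simpa using norm_eulerScheme_sub_le (x := fun k : ℕ => x (a + k * h)) hf hh hε hsmall
    (fun k hk => hR _ (hgrid k hk)) hloc n le_rfl

theorem tendsto_eulerScheme [ProperSpace E] (hf : LocallyLipschitz f) {x w : ℝ → E}
    (hx : Continuous x) {a T : ℝ} (hT : 0 ≤ T)
    (heq : ∀ s t, a ≤ s → s ≤ t → x t - x s = (∫ u in s..t, f (x u)) + (w t - w s)) :
    Tendsto (fun n : ℕ => eulerScheme f (T / n) (x a)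
      (fun k => w (a + (k + 1 : ℕ) * (T / n)) - w (a + k * (T / n))) n) atTop
      (𝓝 (x (a + T))) := by
  have hfx : Continuous fun t => f (x t) := hf.continuous.comp hx
  obtain ⟨R, hR⟩ : ∃ R, ∀ t ∈ Set.Icc a (a + T), ‖x t‖ ≤ R :=
    isCompact_Icc.exists_bound_of_continuousOn hx.continuousOn
  obtain ⟨K, hK⟩ := (hf.locallyLipschitzOn (s := _)).exists_lipschitzOnWith_of_compact
    (isCompact_closedBall (0 : E) (R + 1))
  have huc : UniformContinuousOn (fun t => f (x t)) (Set.Icc a (a + T)) :=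
    isCompact_Icc.uniformContinuousOn_of_continuous hfx.continuousOn
  have herror : ∀ ε, 0 < ε → T * ε * Real.exp (K * T) ≤ 1 → ∀ᶠ n : ℕ in atTop,
      ‖eulerScheme f (T / n) (x a)
        (fun k => w (a + (k + 1 : ℕ) * (T / n)) - w (a + k * (T / n))) n - x (a + T)‖ ≤
        T * ε * Real.exp (K * T) := by
    intro ε hε hsmall
    obtain ⟨η, hη, hosc⟩ := Metric.uniformContinuousOn_iff.1 huc ε hε
    filter_upwards [eventually_gt_atTop 0,
      (tendsto_const_div_atTop_nhds_zero_nat T).eventually_lt_const hη] with n hn hstep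
    have hnT : n * (T / n) = T := by field_simp
    have := norm_eulerScheme_sub_le_of_integral_eq (n := n) (h := T / n) hK hfx (by positivity)
      hε.le (by rwa [hnT]) heq (fun s hs t ht hst => ?_) (by rwa [hnT])
    · rwa [hnT] at this
    · rw [hnT] at hs ht
      exact (dist_eq_norm (f (x s)) _ ▸ hosc s hs t ht (hst.trans_lt hstep)).le
  rw [tendsto_iff_norm_sub_tendsto_zero]
  have hlim : Tendsto (fun ε => T * ε * Real.exp (K * T)) (𝓝[>] 0) (𝓝 0) :=
    tendsto_nhdsWithin_of_tendsto_nhds (Continuous.tendsto' (by fun_prop) _ _ (by simp))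
  refine Metric.tendsto_nhds.2 fun r hr => ?_
  obtain ⟨ε, ⟨hεr, hε1⟩, hε⟩ := ((hlim.eventually_lt_const hr).and
    (hlim.eventually_lt_const one_pos)).and self_mem_nhdsWithin |>.exists
  filter_upwards [herror ε hε hε1.le] with n hn
  simpa using hn.trans_lt hεr

end EulerScheme

/-! ### Uniqueness in law of a transition -/

section IdentDistrib

variable {Ω Ω' : Type*} [MeasurableSpace Ω] [MeasurableSpace Ω'] {P : Measure Ω} {P' : Measure Ω'}

theorem identDistrib_of_tendsto_ae [IsProbabilityMeasure P] [IsProbabilityMeasure P'] {ι E : Type*}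
    {l : Filter ι} [l.NeBot] [l.IsCountablyGenerated] [TopologicalSpace E] [MeasurableSpace E]
    [BorelSpace E] [TopologicalSpace.PseudoMetrizableSpace E] {U : ι → Ω → E} {V : ι → Ω' → E}
    {u : Ω → E} {v : Ω' → E} (hUV : ∀ i, IdentDistrib (U i) (V i) P P')
    (hu : ∀ᵐ ω ∂P, Tendsto (fun i => U i ω) l (𝓝 (u ω)))
    (hv : ∀ᵐ ω ∂P', Tendsto (fun i => V i ω) l (𝓝 (v ω))) : IdentDistrib u v P P' := by
  have hU := fun i => (hUV i).aemeasurable_fst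
  have hV := fun i => (hUV i).aemeasurable_snd
  have hu_meas := aemeasurable_of_tendsto_metrizable_ae l hU hu
  have hv_meas := aemeasurable_of_tendsto_metrizable_ae l hV hv
  have hVv := tendstoInDistribution_of_ae_tendsto hV hv_meas hv
  have hUv : TendstoInDistribution U l v (fun _ => P) P' :=
    ⟨hU, hv_meas, by simpa only [(hUV _).map_eq] using hVv.tendsto⟩
  exact ⟨hu_meas, hv_meas,
    tendstoInDistribution_unique U (tendstoInDistribution_of_ae_tendsto hU hu_meas hu) hUv⟩

theorem identDistrib_of_recursion [IsFiniteMeasure P] {α β : Type*} [MeasurableSpace α]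
    [MeasurableSpace β] {T : α × β → α} (hT : Measurable T) {Z : ℕ → Ω → α} {Z' : ℕ → Ω' → α}
    {ξ : ℕ → Ω → β} {ξ' : ℕ → Ω' → β} (hZ : ∀ k ω, Z (k + 1) ω = T (Z k ω, ξ k ω))
    (hZ' : ∀ k ω, Z' (k + 1) ω = T (Z' k ω, ξ' k ω)) (hind : ∀ k, IndepFun (Z k) (ξ k) P)
    (hind' : ∀ k, IndepFun (Z' k) (ξ' k) P') (h0 : IdentDistrib (Z 0) (Z' 0) P P')
    (hξ : ∀ k, IdentDistrib (ξ k) (ξ' k) P P') (k : ℕ) : IdentDistrib (Z k) (Z' k) P P' := by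
  induction k with
  | zero => exact h0
  | succ k ih =>
    rw [funext (hZ k), funext (hZ' k)]
    exact (ih.prodMk (hξ k) (hind k) (hind' k)).comp hT

end IdentDistrib

theorem continuous_noiseTerm {d m : ℕ} (σ : Matrix (Fin d) (Fin m) ℝ) :
    Continuous (noiseTerm σ) := by
  unfold noiseTerm
  fun_prop

theorem noiseTerm_sub {d m : ℕ} (σ : Matrix (Fin d) (Fin m) ℝ) (ξ η : EuclideanSpace ℝ (Fin m)) :
    noiseTerm σ (ξ - η) = noiseTerm σ ξ - noiseTerm σ η := by
  simp [noiseTerm, Matrix.mulVec_sub]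

section EulerChain

variable {Ω : Type*} {d m : ℕ} {B : ℝ≥0 → Ω → EuclideanSpace ℝ (Fin m)}
  {f : EuclideanSpace ℝ (Fin d) → EuclideanSpace ℝ (Fin d)} {σ : Matrix (Fin d) (Fin m) ℝ}
  {X : ℝ≥0 → Ω → EuclideanSpace ℝ (Fin d)}

/-- The Euler scheme with step `h` for the equation, started from `X` at time `a`: the starting
point, the position after `k` steps and the noise accumulated so far, which together form a Markov
chain driven by the Brownian increments. -/
noncomputable def eulerChain (f : EuclideanSpace ℝ (Fin d) → EuclideanSpace ℝ (Fin d))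
    (σ : Matrix (Fin d) (Fin m) ℝ) (B : ℝ≥0 → Ω → EuclideanSpace ℝ (Fin m))
    (X : ℝ≥0 → Ω → EuclideanSpace ℝ (Fin d)) (a h : ℝ≥0) (k : ℕ) (ω : Ω) :
    EuclideanSpace ℝ (Fin d) × EuclideanSpace ℝ (Fin d) × EuclideanSpace ℝ (Fin m) :=
  (X a ω, eulerScheme f h (X a ω)
    (fun j => noiseTerm σ (B (a + (j + 1 : ℕ) * h) ω) - noiseTerm σ (B (a + j * h) ω)) k,
    B (a + k * h) ω - B a ω)

/-- The map taking a state of `eulerChain` and the next Brownian increment to the next state. -/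
noncomputable def eulerTransition (f : EuclideanSpace ℝ (Fin d) → EuclideanSpace ℝ (Fin d))
    (σ : Matrix (Fin d) (Fin m) ℝ) (h : ℝ≥0)
    (z : (EuclideanSpace ℝ (Fin d) × EuclideanSpace ℝ (Fin d) × EuclideanSpace ℝ (Fin m)) ×
      EuclideanSpace ℝ (Fin m)) :
    EuclideanSpace ℝ (Fin d) × EuclideanSpace ℝ (Fin d) × EuclideanSpace ℝ (Fin m) :=
  (z.1.1, z.1.2.1 + (h : ℝ) • f z.1.2.1 + noiseTerm σ z.2, z.1.2.2 + z.2)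

theorem continuous_eulerTransition (hf : Continuous f) (σ : Matrix (Fin d) (Fin m) ℝ) (h : ℝ≥0) :
    Continuous (eulerTransition f σ h) := by
  have := continuous_noiseTerm σ
  unfold eulerTransition
  fun_prop

theorem eulerChain_zero (a h : ℝ≥0) (ω : Ω) : eulerChain f σ B X a h 0 ω = (X a ω, X a ω, 0) := by
  simp [eulerChain, eulerScheme]

theorem eulerChain_succ (a h : ℝ≥0) (k : ℕ) (ω : Ω) :
    eulerChain f σ B X a h (k + 1) ω = eulerTransition f σ h
      (eulerChain f σ B X a h k ω, B (a + k * h + h) ω - B (a + k * h) ω) := by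
  have hgrid : a + (k + 1 : ℕ) * h = a + k * h + h := by push_cast; ring
  simp only [eulerChain, eulerTransition, eulerScheme, hgrid, noiseTerm_sub]
  simp

end EulerChain

section Transition

variable {Ω Ω' : Type*} [mΩ : MeasurableSpace Ω] [mΩ' : MeasurableSpace Ω'] {d m : ℕ}
  {P : Measure Ω} {P' : Measure Ω'} {ℱ : Filtration ℝ≥0 mΩ} {ℱ' : Filtration ℝ≥0 mΩ'}
  {B : ℝ≥0 → Ω → EuclideanSpace ℝ (Fin m)} {B' : ℝ≥0 → Ω' → EuclideanSpace ℝ (Fin m)}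
  {f : EuclideanSpace ℝ (Fin d) → EuclideanSpace ℝ (Fin d)} {σ : Matrix (Fin d) (Fin m) ℝ}
  {X : ℝ≥0 → Ω → EuclideanSpace ℝ (Fin d)} {X' : ℝ≥0 → Ω' → EuclideanSpace ℝ (Fin d)}

theorem IsFilteredBrownian.measurable (hB : IsFilteredBrownian P ℱ B) (t : ℝ≥0) :
    Measurable (B t) :=
  (hB.adapted t).mono (ℱ.le t) le_rfl

theorem IsFilteredBrownian.identDistrib_increment (hB : IsFilteredBrownian P ℱ B)
    (hB' : IsFilteredBrownian P' ℱ' B') (s s' h : ℝ≥0) :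
    IdentDistrib (fun ω => B (s + h) ω - B s ω) (fun ω => B' (s' + h) ω - B' s' ω) P P' := by
  have hcoord (k : Fin m) : IdentDistrib (fun ω => B (s + h) ω k - B s ω k)
      (fun ω => B' (s' + h) ω k - B' s' ω k) P P' := by
    have hlaw := (hB.isBrownianReal_coord k).toIsPreBrownianReal.hasLaw_sub (s + h) s
    have hlaw' := (hB'.isBrownianReal_coord k).toIsPreBrownianReal.hasLaw_sub (s' + h) s'
    have hdist (r : ℝ≥0) : nndist (r + h).1 r.1 = h := by ext; simp
    rw [hdist] at hlaw hlaw'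
    exact hlaw.identDistrib hlaw'
  have hsub (r : ℝ≥0) : Measurable fun g : ℝ≥0 → ℝ => g (r + h) - g r := by fun_prop
  exact (IdentDistrib.pi hcoord (hB.indep_coord.comp _ fun _ => hsub s)
    (hB'.indep_coord.comp _ fun _ => hsub s')).comp (PiLp.continuous_toLp 2 _).measurable

theorem IsFilteredBrownian.indepFun_increment (hB : IsFilteredBrownian P ℱ B) {E : Type*}
    [MeasurableSpace E] {s : ℝ≥0} {Z : Ω → E} (hZ : Measurable[ℱ s] Z) (h : ℝ≥0) :
    IndepFun Z (fun ω => B (s + h) ω - B s ω) P := by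
  rw [IndepFun_iff_Indep]
  exact indep_of_indep_of_le_left (hB.indep_increment s (s + h) le_self_add).symm hZ.comap_le

theorem IsSDESolution.measurable (hX : IsSDESolution f σ P ℱ B X) (t : ℝ≥0) : Measurable (X t) :=
  (hX.adapted t).mono (ℱ.le t) le_rfl

theorem IsSDESolution.measurable_eulerChain (hX : IsSDESolution f σ P ℱ B X) (hf : Continuous f)
    (a h : ℝ≥0) (k : ℕ) : Measurable[ℱ (a + k * h)] (eulerChain f σ B X a h k) := by
  induction k with
  | zero =>
    rw [funext (eulerChain_zero a h)]
    have hXa : Measurable[ℱ (a + (0 : ℕ) * h)] (X a) :=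
      (hX.adapted a).mono (ℱ.mono (by simp)) le_rfl
    exact hXa.prodMk (hXa.prodMk measurable_const)
  | succ k ih =>
    have hgrid : a + (k + 1 : ℕ) * h = a + k * h + h := by push_cast; ring
    have hle : a + k * h ≤ a + k * h + h := le_self_add
    rw [funext (eulerChain_succ a h k), hgrid]
    exact (continuous_eulerTransition hf σ h).measurable.comp ((ih.mono (ℱ.mono hle) le_rfl).prodMk
      ((hX.brownian.adapted _).sub ((hX.brownian.adapted _).mono (ℱ.mono hle) le_rfl)))

theorem IsSDESolution.identDistrib_eulerChain [IsFiniteMeasure P]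
    (hX : IsSDESolution f σ P ℱ B X) (hX' : IsSDESolution f σ P' ℱ' B' X') (hf : Continuous f)
    {a a' : ℝ≥0} (hlaw : IdentDistrib (X a) (X' a') P P') (h : ℝ≥0) (k : ℕ) :
    IdentDistrib (eulerChain f σ B X a h k) (eulerChain f σ B' X' a' h k) P P' := by
  refine identDistrib_of_recursion (continuous_eulerTransition hf σ h).measurable
    (eulerChain_succ a h) (eulerChain_succ a' h)
    (fun k => hX.brownian.indepFun_increment (hX.measurable_eulerChain hf a h k) h)
    (fun k => hX'.brownian.indepFun_increment (hX'.measurable_eulerChain hf a' h k) h) ?_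
    (fun k => hX.brownian.identDistrib_increment hX'.brownian _ _ h) k
  rw [funext (eulerChain_zero a h), funext (eulerChain_zero a' h)]
  exact hlaw.comp (u := fun x => (x, x, 0)) (by fun_prop)

theorem IsSDESolution.ae_sub_eq_integral (hX : IsSDESolution f σ P ℱ B X) (hf : Continuous f) :
    ∀ᵐ ω ∂P, ∀ s t : ℝ, 0 ≤ s → s ≤ t → X t.toNNReal ω - X s.toNNReal ω =
      (∫ u in s..t, f (X u.toNNReal ω)) +
        (noiseTerm σ (B t.toNNReal ω) - noiseTerm σ (B s.toNNReal ω)) := by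
  filter_upwards [hX.continuous_paths, hX.integral_eq] with ω hcont heq s t hs hst
  have hint (r : ℝ) : IntervalIntegrable (fun u => f (X u.toNNReal ω)) volume 0 r :=
    (hf.comp (hcont.comp continuous_real_toNNReal)).intervalIntegrable _ _
  rw [heq t.toNNReal, heq s.toNNReal, Real.coe_toNNReal _ hs, Real.coe_toNNReal _ (hs.trans hst),
    ← intervalIntegral.integral_interval_sub_left (hint t) (hint s)]
  abel

theorem IsSDESolution.tendsto_eulerChain (hX : IsSDESolution f σ P ℱ B X)
    (hf : LocallyLipschitz f) (a δ : ℝ≥0) :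
    ∀ᵐ ω ∂P, Tendsto (fun n : ℕ => eulerChain f σ B X a (δ / n) n ω) atTop
      (𝓝 (X a ω, X (a + δ) ω, B (a + δ) ω - B a ω)) := by
  filter_upwards [hX.continuous_paths, hX.ae_sub_eq_integral hf.continuous] with ω hcont heq
  have hscheme := tendsto_eulerScheme hf (x := fun t => X t.toNNReal ω)
    (w := fun t => noiseTerm σ (B t.toNNReal ω)) (hcont.comp continuous_real_toNNReal)
    (a := a) δ.coe_nonneg fun s t hs => heq s t (a.coe_nonneg.trans hs)
  have hgrid (n k : ℕ) : ((a : ℝ) + k * ((δ : ℝ) / n)).toNNReal = a + k * (δ / n) := by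
    rw [← Real.toNNReal_coe (r := a + k * (δ / n))]
    push_cast
    rfl
  have hend : ((a : ℝ) + δ).toNNReal = a + δ := by rw [← NNReal.coe_add, Real.toNNReal_coe]
  simp only [hgrid, Real.toNNReal_coe, hend] at hscheme
  refine tendsto_const_nhds.prodMk_nhds (Tendsto.prodMk_nhds ?_ ?_)
  · simpa using hscheme
  · refine tendsto_const_nhds.congr' ?_
    filter_upwards [eventually_ne_atTop 0] with n hn
    rw [mul_div_cancel₀ _ (Nat.cast_ne_zero.2 hn)]

theorem IsSDESolution.identDistrib_transition [IsProbabilityMeasure P] [IsProbabilityMeasure P']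
    (hX : IsSDESolution f σ P ℱ B X) (hX' : IsSDESolution f σ P' ℱ' B' X')
    (hf : LocallyLipschitz f) {a a' : ℝ≥0} (hlaw : IdentDistrib (X a) (X' a') P P') (δ : ℝ≥0) :
    IdentDistrib (fun ω => (X a ω, X (a + δ) ω, B (a + δ) ω - B a ω))
      (fun ω => (X' a' ω, X' (a' + δ) ω, B' (a' + δ) ω - B' a' ω)) P P' :=
  identDistrib_of_tendsto_ae
    (fun n : ℕ => hX.identDistrib_eulerChain hX' hf.continuous hlaw (δ / n) n)
    (hX.tendsto_eulerChain hf a δ) (hX'.tendsto_eulerChain hf a' δ)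

end Transition

/-! ### Linear parametrizations of explicit schemes -/

section Parametrizations

variable {d m p : ℕ} {f : EuclideanSpace ℝ (Fin d) → EuclideanSpace ℝ (Fin d)}

theorem measurable_parametricFlow {φ : Fin (p + 1) → FlowMap d m} {δ : ℝ≥0}
    (hφ : ∀ i, Measurable fun z : EuclideanSpace ℝ (Fin d) × EuclideanSpace ℝ (Fin m) =>
      φ i δ z.1 z.2) (c : Fin (p + 1) → Fin d → ℝ) :
    Measurable fun z : EuclideanSpace ℝ (Fin d) × EuclideanSpace ℝ (Fin m) =>
      parametricFlow φ c δ z.1 z.2 := by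
  unfold parametricFlow
  fun_prop

theorem Parametrizes.measurable {φ : Fin (p + 1) → FlowMap d m} {F : FlowMap d m}
    (hF : Parametrizes φ F) {δ : ℝ≥0} (hδ : 0 < δ) :
    Measurable fun z : EuclideanSpace ℝ (Fin d) × EuclideanSpace ℝ (Fin m) => F δ z.1 z.2 := by
  obtain ⟨hφ, c, hc⟩ := hF δ hδ
  simpa only [hc] using measurable_parametricFlow hφ c

theorem parametrizes_emBasis (hf : Continuous f) (σ : Matrix (Fin d) (Fin m) ℝ) :
    Parametrizes (emBasis f σ) (emFlow f σ) := by
  refine fun δ _ => ⟨fun i => ?_, fun i _ => ![0, 1, 1] i, fun x ξ => ?_⟩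
  · fin_cases i
    · exact measurable_fst
    · exact (hf.comp continuous_fst).measurable
    · exact ((continuous_noiseTerm σ).comp continuous_snd).measurable.const_smul (δ : ℝ)⁻¹
  · ext k
    simp [emFlow, parametricFlow, emBasis, Fin.sum_univ_three]

theorem continuous_rk4Increment (hf : Continuous f) (σ : Matrix (Fin d) (Fin m) ℝ) (δ : ℝ≥0) :
    Continuous fun z : EuclideanSpace ℝ (Fin d) × EuclideanSpace ℝ (Fin m) =>
      rk4Increment f σ δ z.1 z.2 := by
  have := continuous_noiseTerm σ
  unfold rk4Increment
  fun_prop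

theorem measurable_rk4Basis (hf : Continuous f) (σ : Matrix (Fin d) (Fin m) ℝ) (δ : ℝ≥0)
    (i : Fin (2 + 1)) :
    Measurable fun z : EuclideanSpace ℝ (Fin d) × EuclideanSpace ℝ (Fin m) =>
      rk4Basis f σ i δ z.1 z.2 := by
  fin_cases i
  · exact measurable_fst
  · exact (continuous_rk4Increment hf σ δ).measurable
  · exact ((continuous_noiseTerm σ).comp continuous_snd).measurable.const_smul (δ : ℝ)⁻¹

theorem parametrizes_rk4Basis_rk4Increment (hf : Continuous f) (σ : Matrix (Fin d) (Fin m) ℝ) :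
    Parametrizes (rk4Basis f σ) (rk4Increment f σ) := by
  refine fun δ _ => ⟨measurable_rk4Basis hf σ δ, fun i _ => ![0, 1, 0] i, fun x ξ => ?_⟩
  ext k
  simp [parametricFlow, rk4Basis, Fin.sum_univ_three]

theorem parametrizes_rk4Basis_rk4AddNoiseFlow (hf : Continuous f)
    (σ : Matrix (Fin d) (Fin m) ℝ) : Parametrizes (rk4Basis f σ) (rk4AddNoiseFlow f σ) := by
  refine fun δ _ => ⟨measurable_rk4Basis hf σ δ, fun i _ => ![0, 1, 1] i, fun x ξ => ?_⟩
  ext k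
  simp [rk4AddNoiseFlow, parametricFlow, rk4Basis, Fin.sum_univ_three]

end Parametrizations

/-! ### Residual variances as residual sums of squares -/

section Residual

variable {Ω : Type*} {d m p M : ℕ}

/-- The residual `(X_{t_{n+1}} - X_{t_n})/δ - F^δ(X_{t_n}, ΔB_{t_n})` of one step of the scheme with
flow map `F`, whose mean square is `oneStepError`. -/
noncomputable def oneStepResidual (F : FlowMap d m) (B : ℝ≥0 → Ω → EuclideanSpace ℝ (Fin m))
    (X : ℝ≥0 → Ω → EuclideanSpace ℝ (Fin d)) (δ : ℝ≥0) (n : ℕ) (ω : Ω) :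
    EuclideanSpace ℝ (Fin d) :=
  flowIncrement X δ n ω - F δ (X (n * δ) ω) (noiseIncrement B δ n ω)

/-- The design matrix of the regression for the `k`-th component: one row for each observed
transition, one column for each basis function. -/
noncomputable def designMatrix (φ : Fin (p + 1) → FlowMap d m)
    (B : Fin M → ℝ≥0 → Ω → EuclideanSpace ℝ (Fin m))
    (X : Fin M → ℝ≥0 → Ω → EuclideanSpace ℝ (Fin d)) (δ : ℝ≥0) (N : ℕ) (k : Fin d) (ω : Ω) :
    Matrix (Fin M × Fin N) (Fin (p + 1)) ℝ :=
  Matrix.of fun z i =>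
    φ i δ (X z.1 ((z.2 : ℕ) * δ) ω) (noiseIncrement (B z.1) δ (z.2 : ℕ) ω) k

/-- The vector of responses of the regression for the `k`-th component. -/
noncomputable def responseVector (X : Fin M → ℝ≥0 → Ω → EuclideanSpace ℝ (Fin d)) (δ : ℝ≥0)
    (N : ℕ) (k : Fin d) (ω : Ω) : Fin M × Fin N → ℝ :=
  fun z => flowIncrement (X z.1) δ (z.2 : ℕ) ω k

variable (φ : Fin (p + 1) → FlowMap d m) (B : Fin M → ℝ≥0 → Ω → EuclideanSpace ℝ (Fin m))
  (X : Fin M → ℝ≥0 → Ω → EuclideanSpace ℝ (Fin d)) (δ : ℝ≥0) (N : ℕ)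

open scoped Matrix

theorem normalMatrix_eq (k : Fin d) (ω : Ω) :
    normalMatrix φ B X δ N k ω =
      (1 / ((M : ℝ) * N)) • ((designMatrix φ B X δ N k ω)ᵀ * designMatrix φ B X δ N k ω) := by
  ext i j
  simp [normalMatrix, designMatrix, Matrix.mul_apply, Fintype.sum_prod_type, Finset.sum_range]

theorem normalVector_eq (k : Fin d) (ω : Ω) :
    normalVector φ B X δ N k ω =
      (1 / ((M : ℝ) * N)) • ((designMatrix φ B X δ N k ω)ᵀ *ᵥ responseVector X δ N k ω) := by
  ext i
  simp [normalVector, designMatrix, responseVector, Matrix.mulVec, dotProduct,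
    Fintype.sum_prod_type, Finset.sum_range, mul_comm (flowIncrement _ _ _ _ _)]

theorem residualSumSq_designMatrix (c : Fin (p + 1) → Fin d → ℝ) (k : Fin d) (ω : Ω) :
    residualSumSq (designMatrix φ B X δ N k ω) (responseVector X δ N k ω) (fun i => c i k) =
      ∑ r, ∑ n ∈ Finset.range N,
        oneStepResidual (parametricFlow φ c) (B r) (X r) δ n ω k ^ 2 := by
  simp [residualSumSq, designMatrix, responseVector, oneStepResidual, parametricFlow,
    Matrix.mulVec, dotProduct, Fintype.sum_prod_type, Finset.sum_range, mul_comm (c _ _)]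

variable {δ N}

theorem residualSumSq_estimator_le (hM : 0 < M) (hN : 0 < N) (k : Fin d) (ω : Ω)
    (c : Fin (p + 1) → ℝ) :
    residualSumSq (designMatrix φ B X δ N k ω) (responseVector X δ N k ω)
        (fun i => estimator φ B X δ N ω i k) ≤
      residualSumSq (designMatrix φ B X δ N k ω) (responseVector X δ N k ω) c := by
  have hw : 1 / ((M : ℝ) * N) ≠ 0 := by positivity
  simp only [estimator, normalMatrix_eq, normalVector_eq]
  exact residualSumSq_pseudoInverse_le _ _ hw c

theorem residualVarianceCoord_eq (hδ : 0 < δ) (k : Fin d) (ω : Ω) :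
    residualVarianceCoord φ B X δ N k ω = 1 / ((M : ℝ) * N) *
      residualSumSq (designMatrix φ B X δ N k ω) (responseVector X δ N k ω)
        (fun i => estimator φ B X δ N ω i k) := by
  have hδ' : (δ : ℝ) ≠ 0 := NNReal.coe_ne_zero.2 hδ.ne'
  simp only [residualVarianceCoord, residualSumSq_designMatrix, oneStepResidual, flowIncrement,
    PiLp.sub_apply, PiLp.smul_apply, smul_eq_mul, Finset.mul_sum]
  refine Finset.sum_congr rfl fun r _ => Finset.sum_congr rfl fun n _ => ?_
  field_simp

theorem residualVarianceCoord_nonneg (k : Fin d) (ω : Ω) :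
    0 ≤ residualVarianceCoord φ B X δ N k ω := by
  unfold residualVarianceCoord
  positivity

theorem residualVariance_eq_sum (ω : Ω) :
    residualVariance φ B X δ N ω = 2 / d * ∑ k, residualVarianceCoord φ B X δ N k ω := by
  have hcomm (g : Fin d → Fin M → ℕ → ℝ) : ∑ k, ∑ r, ∑ n ∈ Finset.range N, g k r n =
      ∑ r, ∑ n ∈ Finset.range N, ∑ k, g k r n := by
    rw [Finset.sum_comm]
    exact Finset.sum_congr rfl fun r _ => Finset.sum_comm
  simp only [residualVariance, residualVarianceCoord, EuclideanSpace.real_norm_sq_eq,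
    ← Finset.mul_sum]
  rw [hcomm, ← mul_assoc]
  congr 1
  ring

theorem residualVarianceCoord_le (hδ : 0 < δ) (hM : 0 < M) (hN : 0 < N) {F : FlowMap d m}
    (hF : Parametrizes φ F) (k : Fin d) (ω : Ω) :
    residualVarianceCoord φ B X δ N k ω ≤ 1 / ((M : ℝ) * N) *
      ∑ r, ∑ n ∈ Finset.range N, oneStepResidual F (B r) (X r) δ n ω k ^ 2 := by
  obtain ⟨-, c, hc⟩ := hF δ hδ
  have hRSS := residualSumSq_estimator_le φ B X (δ := δ) hM hN k ω fun i => c i k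
  rw [residualSumSq_designMatrix φ B X δ N c] at hRSS
  rw [residualVarianceCoord_eq φ B X hδ]
  simp only [oneStepResidual, hc] at hRSS ⊢
  gcongr

end Residual

/-! ### Expectations of the residual variances -/

theorem enorm_sq_eq_ofReal_sq (x : ℝ) : ‖x‖ₑ ^ 2 = ENNReal.ofReal (x ^ 2) := by
  rw [← enorm_pow, Real.enorm_of_nonneg (sq_nonneg x)]

theorem euclideanSpace_enorm_sq_eq_sum {d : ℕ} (x : EuclideanSpace ℝ (Fin d)) :
    ‖x‖ₑ ^ 2 = ∑ k, ‖x k‖ₑ ^ 2 := by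
  simp only [enorm_sq_eq_ofReal_sq]
  rw [← ofReal_norm, ← ENNReal.ofReal_pow (norm_nonneg _), EuclideanSpace.real_norm_sq_eq,
    ENNReal.ofReal_sum_of_nonneg fun _ _ => sq_nonneg _]

section OneStep

variable {Ω Ω' : Type*} [mΩ : MeasurableSpace Ω] [mΩ' : MeasurableSpace Ω'] {d m : ℕ}
  {P : Measure Ω} {P' : Measure Ω'} {ℱ : Filtration ℝ≥0 mΩ} {ℱ' : Filtration ℝ≥0 mΩ'}
  {B : ℝ≥0 → Ω → EuclideanSpace ℝ (Fin m)} {B' : ℝ≥0 → Ω' → EuclideanSpace ℝ (Fin m)}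
  {f : EuclideanSpace ℝ (Fin d) → EuclideanSpace ℝ (Fin d)} {σ : Matrix (Fin d) (Fin m) ℝ}
  {X : ℝ≥0 → Ω → EuclideanSpace ℝ (Fin d)} {X' : ℝ≥0 → Ω' → EuclideanSpace ℝ (Fin d)}
  {F : FlowMap d m} {δ : ℝ≥0}

theorem IsSDESolution.measurable_oneStepResidual (hX : IsSDESolution f σ P ℱ B X)
    (hF : Measurable fun z : EuclideanSpace ℝ (Fin d) × EuclideanSpace ℝ (Fin m) => F δ z.1 z.2)
    (n : ℕ) : Measurable (oneStepResidual F B X δ n) :=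
  (((hX.measurable _).sub (hX.measurable _)).const_smul (δ : ℝ)⁻¹).sub
    (hF.comp ((hX.measurable _).prodMk
      ((hX.brownian.measurable _).sub (hX.brownian.measurable _))))

theorem IsSDESolution.identDistrib_oneStepResidual [IsProbabilityMeasure P]
    [IsProbabilityMeasure P'] (hX : IsSDESolution f σ P ℱ B X)
    (hX' : IsSDESolution f σ P' ℱ' B' X') (hf : LocallyLipschitz f)
    (hF : Measurable fun z : EuclideanSpace ℝ (Fin d) × EuclideanSpace ℝ (Fin m) => F δ z.1 z.2)
    {n n' : ℕ} (hlaw : IdentDistrib (X (n * δ)) (X' (n' * δ)) P P') :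
    IdentDistrib (oneStepResidual F B X δ n) (oneStepResidual F B' X' δ n') P P' := by
  have hT : Measurable fun z : EuclideanSpace ℝ (Fin d) × EuclideanSpace ℝ (Fin d) ×
      EuclideanSpace ℝ (Fin m) => (δ : ℝ)⁻¹ • (z.2.1 - z.1) - F δ z.1 z.2.2 :=
    ((measurable_snd.fst.sub measurable_fst).const_smul (δ : ℝ)⁻¹).sub
      (hF.comp (measurable_fst.prodMk measurable_snd.snd))
  have hstep := (hX.identDistrib_transition hX' hf hlaw δ).comp hT
  simp only [← add_one_mul] at hstep
  exact hstep

theorem IsSDESolution.oneStepErrorCoord_congr [IsProbabilityMeasure P]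
    [IsProbabilityMeasure P'] (hX : IsSDESolution f σ P ℱ B X)
    (hX' : IsSDESolution f σ P' ℱ' B' X') (hf : LocallyLipschitz f)
    (hF : Measurable fun z : EuclideanSpace ℝ (Fin d) × EuclideanSpace ℝ (Fin m) => F δ z.1 z.2)
    {n n' : ℕ} (hlaw : IdentDistrib (X (n * δ)) (X' (n' * δ)) P P') (k : Fin d) :
    oneStepErrorCoord F P B X δ n k = oneStepErrorCoord F P' B' X' δ n' k :=
  ((hX.identDistrib_oneStepResidual hX' hf hF hlaw).comp
    (u := fun v : EuclideanSpace ℝ (Fin d) => ‖v k‖ₑ ^ 2) (by fun_prop)).lintegral_eq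

theorem IsSDESolution.oneStepError_eq_sum (hX : IsSDESolution f σ P ℱ B X)
    (hF : Measurable fun z : EuclideanSpace ℝ (Fin d) × EuclideanSpace ℝ (Fin m) => F δ z.1 z.2)
    (n : ℕ) : oneStepError F P B X δ n = ∑ k, oneStepErrorCoord F P B X δ n k := by
  have hres := hX.measurable_oneStepResidual hF n
  simp only [oneStepError, euclideanSpace_enorm_sq_eq_sum]
  exact lintegral_finsetSum _ fun k _ => by unfold oneStepResidual at hres; fun_prop

end OneStep

section Sample

variable {Ω : Type*} [mΩ : MeasurableSpace Ω] {d m p M : ℕ} {P : Measure Ω}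
  {f : EuclideanSpace ℝ (Fin d) → EuclideanSpace ℝ (Fin d)} {σ : Matrix (Fin d) (Fin m) ℝ}
  {ℱ : Fin M → Filtration ℝ≥0 mΩ} {B : Fin M → ℝ≥0 → Ω → EuclideanSpace ℝ (Fin m)}
  {X : Fin M → ℝ≥0 → Ω → EuclideanSpace ℝ (Fin d)} {φ : Fin (p + 1) → FlowMap d m}
  {F : FlowMap d m} {δ : ℝ≥0} {N : ℕ}

theorem measurable_residualVarianceCoord (hX : ∀ r, IsSDESolution f σ P (ℱ r) (B r) (X r))
    (hφ : ∀ i, Measurable fun z : EuclideanSpace ℝ (Fin d) × EuclideanSpace ℝ (Fin m) =>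
      φ i δ z.1 z.2) (hδ : 0 < δ) (hM : 0 < M) (hN : 0 < N) (k : Fin d) :
    Measurable (residualVarianceCoord φ B X δ N k) := by
  rw [funext (residualVarianceCoord_eq φ B X hδ k)]
  refine (measurable_eval_minimizer (fun ω => ?_) (fun c => ?_)
    (residualSumSq_estimator_le φ B X hM hN k)).const_mul _
  · unfold residualSumSq
    fun_prop
  · have hres (r : Fin M) (n : ℕ) :=
      (hX r).measurable_oneStepResidual (measurable_parametricFlow hφ fun i _ => c i) n
    simp only [residualSumSq_designMatrix φ B X δ N fun i _ => c i]
    fun_prop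

theorem measurable_residualVariance (hX : ∀ r, IsSDESolution f σ P (ℱ r) (B r) (X r))
    (hφ : ∀ i, Measurable fun z : EuclideanSpace ℝ (Fin d) × EuclideanSpace ℝ (Fin m) =>
      φ i δ z.1 z.2) (hδ : 0 < δ) (hM : 0 < M) (hN : 0 < N) :
    Measurable (residualVariance φ B X δ N) := by
  rw [funext (residualVariance_eq_sum φ B X)]
  exact (Finset.measurable_sum _ fun k _ =>
    measurable_residualVarianceCoord hX hφ hδ hM hN k).const_mul _

theorem lintegral_residualVarianceCoord_le_mean
    (hX : ∀ r, IsSDESolution f σ P (ℱ r) (B r) (X r)) (hF : Parametrizes φ F) (hδ : 0 < δ)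
    (hM : 0 < M) (hN : 0 < N) (k : Fin d) :
    ∫⁻ ω, ENNReal.ofReal (residualVarianceCoord φ B X δ N k ω) ∂P ≤
      ENNReal.ofReal (1 / ((M : ℝ) * N)) *
        ∑ r, ∑ n ∈ Finset.range N, oneStepErrorCoord F P (B r) (X r) δ n k := by
  have hres (r : Fin M) (n : ℕ) : Measurable fun ω =>
      ENNReal.ofReal (oneStepResidual F (B r) (X r) δ n ω k ^ 2) := by
    have := (hX r).measurable_oneStepResidual (hF.measurable hδ) n
    fun_prop
  calc ∫⁻ ω, ENNReal.ofReal (residualVarianceCoord φ B X δ N k ω) ∂P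
    _ ≤ ∫⁻ ω, ENNReal.ofReal (1 / ((M : ℝ) * N)) * ∑ r, ∑ n ∈ Finset.range N,
          ENNReal.ofReal (oneStepResidual F (B r) (X r) δ n ω k ^ 2) ∂P := by
      refine lintegral_mono fun ω =>
        (ENNReal.ofReal_le_ofReal (residualVarianceCoord_le φ B X hδ hM hN hF k ω)).trans_eq ?_
      rw [ENNReal.ofReal_mul (by positivity), ENNReal.ofReal_sum_of_nonneg fun _ _ => by positivity]
      simp only [ENNReal.ofReal_sum_of_nonneg fun _ _ => sq_nonneg _]
    _ = ENNReal.ofReal (1 / ((M : ℝ) * N)) * ∑ r, ∑ n ∈ Finset.range N,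
          ∫⁻ ω, ENNReal.ofReal (oneStepResidual F (B r) (X r) δ n ω k ^ 2) ∂P := by
      rw [lintegral_const_mul _ (by fun_prop), lintegral_finsetSum _ fun r _ => by fun_prop]
      simp only [lintegral_finsetSum _ fun n _ => hres _ n]
    _ = _ := by simp only [← enorm_sq_eq_ofReal_sq]; rfl

theorem lintegral_residualVarianceCoord_le [IsProbabilityMeasure P]
    (hX : ∀ r, IsSDESolution f σ P (ℱ r) (B r) (X r)) (hf : LocallyLipschitz f)
    (hlaw : ∀ r r' t t', IdentDistrib (X r t) (X r' t') P P) (hF : Parametrizes φ F) (hδ : 0 < δ)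
    (hN : 0 < N) (k : Fin d) (r : Fin M) (n : ℕ) :
    ∫⁻ ω, ENNReal.ofReal (residualVarianceCoord φ B X δ N k ω) ∂P ≤
      oneStepErrorCoord F P (B r) (X r) δ n k := by
  have hw : 0 < (M : ℝ) * N := by have := r.pos; positivity
  refine (lintegral_residualVarianceCoord_le_mean hX hF hδ r.pos hN k).trans_eq ?_
  have herr (r' : Fin M) (n' : ℕ) : oneStepErrorCoord F P (B r') (X r') δ n' k =
      oneStepErrorCoord F P (B r) (X r) δ n k :=
    (hX r').oneStepErrorCoord_congr (hX r) hf (hF.measurable hδ) (hlaw _ _ _ _) k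
  have hcount : (M : ℝ≥0∞) * N = ENNReal.ofReal ((M : ℝ) * N) := by
    rw [ENNReal.ofReal_mul (by positivity), ENNReal.ofReal_natCast, ENNReal.ofReal_natCast]
  simp only [herr, Finset.sum_const, Finset.card_range, Finset.card_univ, Fintype.card_fin,
    nsmul_eq_mul]
  rw [← mul_assoc (M : ℝ≥0∞), hcount, ← mul_assoc, ← ENNReal.ofReal_mul (by positivity),
    one_div_mul_cancel hw.ne', ENNReal.ofReal_one, one_mul]

theorem lintegral_residualVariance_le [IsProbabilityMeasure P]
    (hX : ∀ r, IsSDESolution f σ P (ℱ r) (B r) (X r)) (hf : LocallyLipschitz f)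
    (hlaw : ∀ r r' t t', IdentDistrib (X r t) (X r' t') P P) (hF : Parametrizes φ F) (hd : 0 < d)
    (hδ : 0 < δ) (hN : 0 < N) (r : Fin M) (n : ℕ) :
    ∫⁻ ω, ENNReal.ofReal (residualVariance φ B X δ N ω) ∂P ≤
      2 / (d : ℝ≥0∞) * oneStepError F P (B r) (X r) δ n := by
  have hmeas (k : Fin d) : Measurable (residualVarianceCoord φ B X δ N k) :=
    measurable_residualVarianceCoord hX (hF δ hδ).1 hδ r.pos hN k
  have hfactor : ENNReal.ofReal (2 / (d : ℝ)) = 2 / (d : ℝ≥0∞) := by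
    rw [ENNReal.ofReal_div_of_pos (Nat.cast_pos.2 hd), ENNReal.ofReal_ofNat,
      ENNReal.ofReal_natCast]
  calc ∫⁻ ω, ENNReal.ofReal (residualVariance φ B X δ N ω) ∂P
    _ = ∫⁻ ω, 2 / (d : ℝ≥0∞) *
          ∑ k, ENNReal.ofReal (residualVarianceCoord φ B X δ N k ω) ∂P := by
      refine lintegral_congr fun ω => ?_
      rw [residualVariance_eq_sum, ENNReal.ofReal_mul (by positivity), hfactor,
        ENNReal.ofReal_sum_of_nonneg fun k _ => residualVarianceCoord_nonneg φ B X k ω]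
    _ = 2 / (d : ℝ≥0∞) *
          ∑ k, ∫⁻ ω, ENNReal.ofReal (residualVarianceCoord φ B X δ N k ω) ∂P := by
      rw [lintegral_const_mul _ (by fun_prop), lintegral_finsetSum _ fun k _ => by fun_prop]
    _ ≤ 2 / (d : ℝ≥0∞) * oneStepError F P (B r) (X r) δ n := by
      rw [(hX r).oneStepError_eq_sum (hF.measurable hδ)]
      gcongr with k
      exact lintegral_residualVarianceCoord_le hX hf hlaw hF hδ hN k r n

end Sample

theorem HasOneStepStrongOrder.of_le_const_mul {e e' : ℝ≥0 → ℝ≥0∞} {γ : ℝ}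
    (he : HasOneStepStrongOrder e γ) (c : ℝ≥0) (hle : ∀ δ, 0 < δ → e' δ ≤ c * e δ) :
    HasOneStepStrongOrder e' γ := by
  obtain ⟨C, hC⟩ := he
  refine ⟨c * C, ?_⟩
  filter_upwards [hC, self_mem_nhdsWithin] with δ hCδ hδ
  rw [mul_assoc, ENNReal.coe_mul]
  exact (hle δ hδ).trans (by gcongr)

theorem theorem3_general {d m M : ℕ} (hd : 0 < d) (hM : 0 < M)
    (f : EuclideanSpace ℝ (Fin d) → EuclideanSpace ℝ (Fin d)) (hf : LocallyLipschitz f)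
    (σ : Matrix (Fin d) (Fin m) ℝ) (μ : Measure (EuclideanSpace ℝ (Fin d)))
    {Ω : Type*} [mΩ : MeasurableSpace Ω] (P : Measure Ω) [IsProbabilityMeasure P]
    (ℱ : Fin M → Filtration ℝ≥0 mΩ)
    (B : Fin M → ℝ≥0 → Ω → EuclideanSpace ℝ (Fin m))
    (X : Fin M → ℝ≥0 → Ω → EuclideanSpace ℝ (Fin d))
    (hX : ∀ r, IsSDESolution f σ P (ℱ r) (B r) (X r)) (hμ : ∀ r t, P.map (X r t) = μ) :
    Parametrizes (emBasis f σ) (emFlow f σ) ∧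
    Parametrizes (rk4Basis f σ) (rk4Increment f σ) ∧
    Parametrizes (rk4Basis f σ) (rk4AddNoiseFlow f σ) ∧
    ∀ (p : ℕ) (φ : Fin (p + 1) → FlowMap d m) (F : FlowMap d m), Parametrizes φ F →
      (∀ (δ : ℝ≥0) (N : ℕ), 0 < δ → 0 < N →
        (∀ k : Fin d, AEMeasurable (residualVarianceCoord φ B X δ N k) P ∧
          ∀ (r : Fin M) (n : ℕ),
            ∫⁻ ω, ENNReal.ofReal (residualVarianceCoord φ B X δ N k ω) ∂P
              ≤ oneStepErrorCoord F P (B r) (X r) δ n k) ∧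
        AEMeasurable (residualVariance φ B X δ N) P ∧
        ∀ (r : Fin M) (n : ℕ),
          ∫⁻ ω, ENNReal.ofReal (residualVariance φ B X δ N ω) ∂P
            ≤ 2 / (d : ℝ≥0∞) * oneStepError F P (B r) (X r) δ n) ∧
      (∀ (γ : ℝ) (r : Fin M) (n : ℕ) (N : ℝ≥0 → ℕ), (∀ δ, 0 < N δ) →
        HasOneStepStrongOrder (fun δ => oneStepError F P (B r) (X r) δ n) γ →
        HasOneStepStrongOrder
          (fun δ => ∫⁻ ω, ENNReal.ofReal (residualVariance φ B X δ (N δ) ω) ∂P) γ) := by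
  refine ⟨parametrizes_emBasis hf.continuous σ, parametrizes_rk4Basis_rk4Increment hf.continuous σ,
    parametrizes_rk4Basis_rk4AddNoiseFlow hf.continuous σ, fun p φ F hF => ?_⟩
  have hlaw (r r' : Fin M) (t t' : ℝ≥0) : IdentDistrib (X r t) (X r' t') P P :=
    ⟨((hX r).measurable t).aemeasurable, ((hX r').measurable t').aemeasurable, by rw [hμ, hμ]⟩
  have hle (δ : ℝ≥0) (N : ℕ) (hδ : 0 < δ) (hN : 0 < N) (r : Fin M) (n : ℕ) :=
    lintegral_residualVariance_le hX hf hlaw hF hd hδ hN r n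
  refine ⟨fun δ N hδ hN => ⟨fun k => ⟨?_, lintegral_residualVarianceCoord_le hX hf hlaw hF hδ hN k⟩,
    ?_, hle δ N hδ hN⟩, fun γ r n N hN he => he.of_le_const_mul (2 / d) fun δ hδ => ?_⟩
  · exact (measurable_residualVarianceCoord hX (hF δ hδ).1 hδ hM hN k).aemeasurable
  · exact (measurable_residualVariance hX (hF δ hδ).1 hδ hM hN).aemeasurable
  · simpa [ENNReal.coe_div (Nat.cast_ne_zero.2 hd.ne' : (d : ℝ≥0) ≠ 0)] using
      hle δ (N δ) hδ (hN δ) r n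

theorem theorem3 {d m M : ℕ} (hd : 0 < d) (hM : 0 < M)
    (f : EuclideanSpace ℝ (Fin d) → EuclideanSpace ℝ (Fin d)) (hf : LocallyLipschitz f)
    (σ : Matrix (Fin d) (Fin m) ℝ)
    (μ : Measure (EuclideanSpace ℝ (Fin d))) (hμ : IsInvariantLaw.{u} f σ μ)
    {Ω : Type u} [mΩ : MeasurableSpace Ω] (P : Measure Ω) [IsProbabilityMeasure P]
    (ℱ : Fin M → Filtration ℝ≥0 mΩ)
    (B : Fin M → ℝ≥0 → Ω → EuclideanSpace ℝ (Fin m))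
    (X : Fin M → ℝ≥0 → Ω → EuclideanSpace ℝ (Fin d))
    (hdata : IsTrajectorySample f σ μ P ℱ B X) :
    -- IS-EM and IS-RK4 are parametrizations of their explicit schemes
    Parametrizes (emBasis f σ) (emFlow f σ) ∧
    Parametrizes (rk4Basis f σ) (rk4Increment f σ) ∧
    Parametrizes (rk4Basis f σ) (rk4AddNoiseFlow f σ) ∧
    ∀ (p : ℕ) (φ : Fin (p + 1) → FlowMap d m) (F : FlowMap d m), Parametrizes φ F →
      -- the residual of the inferred scheme is controlled by that of the explicit scheme
      (∀ (δ : ℝ≥0) (N : ℕ), 0 < δ → 0 < N →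
        (∀ k : Fin d, AEMeasurable (residualVarianceCoord φ B X δ N k) P ∧
          ∀ (r : Fin M) (n : ℕ),
            ∫⁻ ω, ENNReal.ofReal (residualVarianceCoord φ B X δ N k ω) ∂P
              ≤ oneStepErrorCoord F P (B r) (X r) δ n k) ∧
        AEMeasurable (residualVariance φ B X δ N) P ∧
        ∀ (r : Fin M) (n : ℕ),
          ∫⁻ ω, ENNReal.ofReal (residualVariance φ B X δ N ω) ∂P
            ≤ 2 / (d : ℝ≥0∞) * oneStepError F P (B r) (X r) δ n) ∧
      -- the inferred scheme inherits the one-step strong order of the explicit scheme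
      (∀ (γ : ℝ) (r : Fin M) (n : ℕ) (N : ℝ≥0 → ℕ), (∀ δ, 0 < N δ) →
        HasOneStepStrongOrder (fun δ => oneStepError F P (B r) (X r) δ n) γ →
        HasOneStepStrongOrder
          (fun δ => ∫⁻ ω, ENNReal.ofReal (residualVariance φ B X δ (N δ) ω) ∂P) γ) := by
  exact theorem3_general hd hM f hf σ μ P ℱ B X hdata.solution fun r =>
    hμ Ω mΩ P ‹_› _ _ _ (hdata.solution r) (hdata.initial r)
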